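/- Let $d,m,n\ge 0$ be integers, let $k:\mathbb R^d\times\mathbb R^d\to[0,\infty)$ be a Lipschitz continuous kernel, and let $f=(f_1,\dots,f_m):\mathbb R^d\to\mathbb R^m$ be random, where $f_1,\dots,f_m$ are independent Gaussian processes with mean $0$ and covariance function $k$. Each agent $i\in\{1,\dots,n\}$ has $M_i\ge 1$ fixed inputs $p_i^{(1)},\dots,p_i^{(M_i)}\in\mathbb R^d$ and noisy measurements $y_{ij}^{(a)}=f_j(p_i^{(a)})+\zeta_{ij}^{(a)}$, $1\le j\le m$, $1\le a\le M_i$, where all $\zeta_{ij}^{(a)}$ are independent, independent of $f$ and distributed as $\mathcal N(0,\sigma_o^2)$, $\sigma_o>0$. With $\mathbf k_i(p)=[k(p_i^{(1)},p),\dots,k(p_i^{(M_i)},p)]^\top$, $\mathbf K_i=[k(p_i^{(a)},p_i^{(b)})]_{a,b}+\sigma_o^2 I$ and $\mathbf y_{ij}=[y_{ij}^{(1)},\dots,y_{ij}^{(M_i)}]^\top$, the posterior mean and variance of agent $i$ are $$\mu_{ij}(p)=\mathbf k_i(p)^\top\mathbf K_i^{-1}\mathbf y_{ij},\qquad \sigma_{ij}^2(p)=\sigma_i^2(p)=k(p,p)-\mathbf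 k_i(p)^\top\mathbf K_i^{-1}\mathbf k_i(p).$$ *Aggregation (Cora-GP).* Let $\mathcal N_i\subseteq\{1,\dots,n\}$ be the nonempty set of agents (neighbours, with or without $i$ itself) whose predictions agent $i$ aggregates, let $\sigma_{g_i}>0$, and let $s_{il}(p)$, $l\in\mathcal N_i$, be either the vector of the $\min_{l'\in\mathcal N_i}M_{l'}$ largest entries of $\mathbf k_l(p)$ (variant Top) or the average of the entries of $\mathbf k_l(p)$ (variant Avg). Put $c_{il}(p)=\|s_{il}(p)\|/\sum_{l'\in\mathcal N_i}\|s_{il'}(p)\|$ (with $0/0:=0$), $\bar w_i(p)=\max_{l\in\mathcal N_i}c_{il}(p)$, $$w_{il}(p)=\frac1{\sigma_{g_i}\sqrt{2\pi}}\exp\Big(-\frac{(c_{il}(p)-\bar w_i(p))^2}{2\sigma_{g_i}^2}\Big),\qquad h_{il}(p)=\frac{w_{il}(p)}{\sum_{l'\in\mathcal N_i}w_{il'}(p)}\ \ (l\in\mathcal N_i),\qquad h_{il}(p)=0\ \ (l\notin\mathcal N_i),$$ and $\tilde\mu_{ij}(p)=\sum_{l=1}^n h_{il}(p)\mu_{lj}(p)$,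 $\tilde\mu_i=[\tilde\mu_{i1},\dots,\tilde\mu_{im}]^\top$. *Bound.* Let $\Omega\subset\mathbb R^d$ be compact with diameter $r_\Omega$, $\tau>0$ and $\delta\in(0,1)$. Let $\kappa_\tau=\frac{r_\Omega\sqrt d}{2\tau}$ if this number is at least $6$, and otherwise let $\kappa_\tau$ be the least integer $\ge 1$ that is at least $\frac{r_\Omega\sqrt d}{2\tau}$. For $\epsilon>0$ put $$\varphi(\tau,\epsilon)=2d\log\kappa_\tau-2\log\epsilon,\qquad \gamma_{ij}(\tau)=(L_f+L_{\mu_{ij}})\tau+\sqrt{\varphi(\tau,\delta)\,L_{\sigma_i^2}\,\tau},$$ $$\eta_{ij}(p,\delta)=2\sqrt{\varphi(\tau,\delta/n)}\,\sum_{l=1}^n h_{il}(p)\,\sigma_l(p),\qquad \tilde\eta_i(p,\delta)=\|[\eta_{i1}(p,\delta),\dots,\eta_{im}(p,\delta)]\|.$$ Then there is an event of probability at least $(1-\delta)^m$ on which the following holds: whenever $L_f,L_{\mu_{ij}},L_{\sigma_i^2}\ge0$ are Lipschitz constants on the convex hull of $\Omega$ of all realized components $f_j$, of the posterior means $\mu_{ij}$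 and of the posterior variances $\sigma_i^2$, respectively, and $$\sigma_{i}^2(p)\ \ge\ \gamma_{ij}^2(\tau)/\varphi(\tau,\delta)\qquad\text{for all }p\in\Omega,\ 1\le i\le n,\ 1\le j\le m,$$ then for either variant and for all nonempty sets $\mathcal N_i$ and all $\sigma_{g_i}>0$, $$\|f(p)-\tilde\mu_i(p)\|\le\tilde\eta_i(p,\delta)\qquad\text{for all }i=1,\dots,n\text{ and all }p\in\Omega .$$ -/

import Mathlib

open MeasureTheory ProbabilityTheory
open scoped NNReal Matrix

noncomputable section

/-- The input space `ℝ^d` with its Euclidean norm. -/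
abbrev Input (d : ℕ) : Type := EuclideanSpace ℝ (Fin d)

/-- `g` is a Gaussian process indexed by `ℝ^d` with mean zero and covariance function `k`. -/
structure IsCenteredGP {Ω : Type*} [MeasurableSpace Ω] {d : ℕ} (k : Input d → Input d → ℝ)
    (g : Input d → Ω → ℝ) (P : Measure Ω) : Prop where
  gaussian : IsGaussianProcess g P
  mean_zero : ∀ p, ∫ ω, g p ω ∂P = 0
  cov_eq : ∀ p p', covariance (g p) (g p') P = k p p'

/-! ### Gaussian process regression of one agent -/

/-- The vector `k(P, p) = [k(p⁽¹⁾, p), …, k(p⁽ᴹ⁾, p)]ᵀ`. -/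
def kVec {d M : ℕ} (k : Input d → Input d → ℝ) (X : Fin M → Input d) (p : Input d) : Fin M → ℝ :=
  fun a => k (X a) p

/-- The matrix `K(P, P) + σₒ² I`. -/
def noisyGram {d M : ℕ} (k : Input d → Input d → ℝ) (X : Fin M → Input d) (σo : ℝ) :
    Matrix (Fin M) (Fin M) ℝ :=
  Matrix.of (fun a b => k (X a) (X b)) + σo ^ 2 • (1 : Matrix (Fin M) (Fin M) ℝ)

/-- The posterior mean `k(P, p)ᵀ (K(P, P) + σₒ² I)⁻¹ Y`. -/
def postMean {d M : ℕ} (k : Input d → Input d → ℝ) (X : Fin M → Input d) (σo : ℝ)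
    (Y : Fin M → ℝ) (p : Input d) : ℝ :=
  kVec k X p ⬝ᵥ ((noisyGram k X σo)⁻¹ *ᵥ Y)

/-- The posterior variance `k(p, p) - k(P, p)ᵀ (K(P, P) + σₒ² I)⁻¹ k(P, p)`. -/
def postVar {d M : ℕ} (k : Input d → Input d → ℝ) (X : Fin M → Input d) (σo : ℝ)
    (p : Input d) : ℝ :=
  k p p - kVec k X p ⬝ᵥ ((noisyGram k X σo)⁻¹ *ᵥ kVec k X p)

/-- The posterior standard deviation. It is the same for all output components, since these share
the kernel, the training inputs and the noise level. -/
def postStd {d M : ℕ} (k : Input d → Input d → ℝ) (X : Fin M → Input d) (σo : ℝ)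
    (p : Input d) : ℝ :=
  Real.sqrt (postVar k X σo p)

/-! ### The Cora-GP aggregation weights -/

/-- The two variants of Cora-GP. -/
inductive CoraOption : Type
  | top
  | avg

/-- `Top(v, N)`: the first `N` entries of `v` sorted in decreasing order. -/
def topVec {M : ℕ} (v : Fin M → ℝ) (N : ℕ) : EuclideanSpace ℝ (Fin N) :=
  WithLp.toLp 2 fun a => ((List.ofFn v).insertionSort (fun x y => y ≤ x)).getD a 0

section Weights

variable {d n : ℕ} (k : Input d → Input d → ℝ) (M : Fin n → ℕ)
  (X : (i : Fin n) → Fin (M i) → Input d)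

/-- `M_i^min`, the least number of training samples among the neighbours `l ∈ N`. -/
def minSamples (N : Finset (Fin n)) : ℕ := sInf (M '' (N : Set (Fin n)))

open Classical in
/-- The norm `‖s_{il}(p)‖` of the correlation function, for an agent with neighbour set `N`. -/
def corrNorm (opt : CoraOption) (N : Finset (Fin n)) (l : Fin n) (p : Input d) : ℝ :=
  if l ∈ N then
    match opt with
    | CoraOption.top => ‖topVec (kVec k (X l) p) (minSamples M N)‖
    | CoraOption.avg => ‖(∑ a, kVec k (X l) p a) / (M l : ℝ)‖
  else 0

open Classical in
/-- The `0`-`1` communication coefficient of an agent with neighbour set `N`. -/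
def adjCheck (N : Finset (Fin n)) (l : Fin n) : ℝ := if l ∈ N then 1 else 0

/-- The normalisation `s̃_i(p) = ∑_{l ∈ N} ǎ_{il} ‖s_{il}(p)‖`. -/
def corrSum (opt : CoraOption) (N : Finset (Fin n)) (p : Input d) : ℝ :=
  ∑ l ∈ N, adjCheck N l * corrNorm k M X opt N l p

/-- `w̄_i(p)`, the maximum over `l` of `ǎ_{il} ‖s_{il}(p)‖ / s̃_i(p)`. -/
def wBar (opt : CoraOption) (N : Finset (Fin n)) (p : Input d) : ℝ :=
  ⨆ l : Fin n, adjCheck N l * corrNorm k M X opt N l p / corrSum k M X opt N p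

/-- The unnormalised weight `w_{il}(p)`. -/
def weight (opt : CoraOption) (N : Finset (Fin n)) (σg : ℝ) (l : Fin n) (p : Input d) : ℝ :=
  adjCheck N l / (σg * Real.sqrt (2 * Real.pi)) *
    Real.exp (-(corrNorm k M X opt N l p / corrSum k M X opt N p - wBar k M X opt N p) ^ 2 /
      (2 * σg ^ 2))

open Classical in
/-- The aggregation weight `h_{il}(p)`. -/
def aggWeight (opt : CoraOption) (N : Finset (Fin n)) (σg : ℝ) (l : Fin n) (p : Input d) : ℝ :=
  if l ∈ N then
    weight k M X opt N σg l p / ∑ l' ∈ N, weight k M X opt N σg l' p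
  else 0

/-- The aggregated posterior mean `μ̃_i(p) ∈ ℝ^m`, whose component `j` is `h_i(p)ᵀ μ^j(p)`. Here
`Y l j` is the vector of the `j`-th components of the training targets of agent `l`. -/
def aggMean {m : ℕ} (σo : ℝ) (Y : (l : Fin n) → Fin m → Fin (M l) → ℝ) (opt : CoraOption)
    (N : Finset (Fin n)) (σg : ℝ) (p : Input d) : EuclideanSpace ℝ (Fin m) :=
  WithLp.toLp 2 fun j =>
    ∑ l, aggWeight k M X opt N σg l p * postMean k (X l) σo (Y l j) p

end Weights

/-! ### The quantities of the error bound -/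

/-- The number of cells per axis of a grid of cubes with diagonal `2τ` on a hypercube of edge `r`
in `ℝ^d`: the ratio `r √d / (2τ)`, rounded up to a positive integer if it is smaller than `6`. -/
def cellsPerAxis (d : ℕ) (r τ : ℝ) : ℝ :=
  if 6 ≤ r * Real.sqrt d / (2 * τ) then r * Real.sqrt d / (2 * τ)
  else max 1 (⌈r * Real.sqrt d / (2 * τ)⌉₊ : ℝ)

/-- `φ(τ, δ)`, for a set of diameter `r` in `ℝ^d`. -/
def phi (d : ℕ) (r τ δ : ℝ) : ℝ :=
  2 * d * Real.log (cellsPerAxis d r τ) - 2 * Real.log δ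

/-- `γ(τ)`, for Lipschitz constants `Lf`, `Lμ`, `Lσ` of a component of the unknown function, of a
posterior mean and of a posterior variance. -/
def gammaTerm (d : ℕ) (r τ δ Lf Lμ Lσ : ℝ) : ℝ :=
  (Lf + Lμ) * τ + Real.sqrt (phi d r τ δ * Lσ * τ)

/-- `η_{ij}(p, δ) = 2 √φ(τ, δ/n) h_i(p)ᵀ σ^j(p)`. It is the same for all `j`. -/
def etaTerm {d n : ℕ} (k : Input d → Input d → ℝ) (M : Fin n → ℕ)
    (X : (i : Fin n) → Fin (M i) → Input d) (σo : ℝ) (opt : CoraOption) (N : Finset (Fin n))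
    (σg r τ δ : ℝ) (p : Input d) : ℝ :=
  2 * Real.sqrt (phi d r τ (δ / n)) *
    ∑ l, aggWeight k M X opt N σg l p * postStd k (X l) σo p

/-- `η̃_i(p, δ) = ‖[η_{i1}(p, δ), …, η_{im}(p, δ)]‖`. -/
def etaTilde {d n : ℕ} (m : ℕ) (k : Input d → Input d → ℝ) (M : Fin n → ℕ)
    (X : (i : Fin n) → Fin (M i) → Input d) (σo : ℝ) (opt : CoraOption) (N : Finset (Fin n))
    (σg r τ δ : ℝ) (p : Input d) : ℝ :=
  ‖(WithLp.toLp 2 fun _ => etaTerm k M X σo opt N σg r τ δ p : EuclideanSpace ℝ (Fin m))‖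

end

/-!
Everything is reduced to finitely many Gaussian tail events and then extended by Lipschitz
continuity.

At a fixed point `q` the residual `f_j(q) - μ_{ij}(q)` is a linear combination of jointly Gaussian
variables, and its variance is the posterior variance `σ_i²(q)`
(`IsCenteredGP.map_sub_postMean`). A union bound over the agents and over a `τ`-net `T` of `K`
controls all residuals on `T` by `√φ(τ, δ/n) σ_i` (`IsCenteredGP.one_sub_le_concentrationSet`,
`card_mul_tail_le`). The pairs of a component `f_j` and its noise are independent over `j`
(`iIndepFun_prodMk`), which gives the probability `(1 - δ) ^ m`. From the net to a point at distance
at most `τ`, the lower bound on the posterior variance absorbs the discretisation error into a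
second copy of `√φ σ_i` (`abs_sub_le_of_net`), and the aggregation weights form a convex combination
(`norm_sub_aggMean_le`).

The delicate point is the size of the net (`exists_net_card_le`). With `κ = cellsPerAxis d r τ`, the
function `φ` pays for `κ ^ d` points. If `κ` is an integer, a grid of cubes achieves this; its
centres are moved into the convex hull of `K` by the metric projection. For non-integral `κ ≥ 6`
there is a factor to spare, because Mills' bound improves on `exp (-β² / 2)` by the factor
`√(2 / π) / β` and here `β² ≥ 2 d log 6`. In dimension `d ≤ 13` this pays for rounding `κ` up. In
dimension `d ≥ 14` a maximal `τ`-separated subset of `K` is small enough by a comparison of volumes,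
since `K` lies in a ball of radius `(√3 / 2) r`.
-/

/-! ### Tails of the standard Gaussian -/

lemma gaussianPDFReal_add_eq (β x : ℝ) :
    gaussianPDFReal 0 1 (x + β) =
      (√(2 * Real.pi))⁻¹ * Real.exp (-β ^ 2 / 2) *
        (Real.exp (-β * x) * Real.exp (-(1 / 2) * x ^ 2)) := by
  simp only [gaussianPDFReal, NNReal.coe_one, mul_one, mul_assoc, ← Real.exp_add]
  congr 2
  ring

/-- The substitution `x ↦ x + β` turns a Gaussian tail into `exp (-β ^ 2 / 2)` times an integral
over the half-line, from which both tail estimates below are read off. -/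
lemma gaussianReal_Ioi (β : ℝ) :
    (gaussianReal 0 1).real (Set.Ioi β) = (√(2 * Real.pi))⁻¹ * Real.exp (-β ^ 2 / 2) *
      ∫ x in Set.Ioi (0 : ℝ), Real.exp (-β * x) * Real.exp (-(1 / 2) * x ^ 2) := by
  rw [measureReal_def, gaussianReal_apply_eq_integral _ one_ne_zero,
    ENNReal.toReal_ofReal (integral_nonneg fun x => gaussianPDFReal_nonneg _ _ _),
    ← integral_const_mul]
  simp_rw [← gaussianPDFReal_add_eq]
  rw [← (measurePreserving_add_right volume β).setIntegral_preimage_emb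
    (measurableEmbedding_addRight β)]
  simp

lemma gaussianReal_abs_gt (β : ℝ) (hβ : 0 ≤ β) :
    (gaussianReal 0 1).real {x | β < |x|} = 2 * (gaussianReal 0 1).real (Set.Ioi β) := by
  have h : {x : ℝ | β < |x|} = Set.Ioi β ∪ Set.Iio (-β) := by
    ext x
    simp [lt_abs, lt_neg]
  have hneg : (gaussianReal 0 1).real (Set.Iio (-β)) = (gaussianReal 0 1).real (Set.Ioi β) := by
    conv_lhs => rw [← neg_zero, ← gaussianReal_map_neg]
    rw [map_measureReal_apply measurable_neg measurableSet_Iio]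
    simp
  rw [h, measureReal_union _ measurableSet_Iio, hneg, two_mul]
  rw [Set.disjoint_left]
  intro x hx hx'
  simp only [Set.mem_Ioi, Set.mem_Iio] at hx hx'
  linarith

lemma integrableOn_exp_neg_half_sq :
    IntegrableOn (fun x : ℝ => Real.exp (-(1 / 2) * x ^ 2)) (Set.Ioi 0) :=
  (integrable_exp_neg_mul_sq (by norm_num)).integrableOn

/-- The constant `1` for the two-sided tail, in place of the `2` of the Chernoff bound, is what `φ`
requires. -/
lemma gaussianReal_tail_le_exp (β : ℝ) (hβ : 0 ≤ β) :
    (gaussianReal 0 1).real {x | β < |x|} ≤ Real.exp (-β ^ 2 / 2) := by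
  have h : ∫ x in Set.Ioi (0 : ℝ), Real.exp (-β * x) * Real.exp (-(1 / 2) * x ^ 2)
      ≤ √(2 * Real.pi) / 2 := by
    have : √(2 * Real.pi) / 2 = ∫ x in Set.Ioi (0 : ℝ), Real.exp (-(1 / 2) * x ^ 2) := by
      rw [integral_gaussian_Ioi]
      congr 2
      ring
    rw [this]
    refine integral_mono_of_nonneg (Filter.Eventually.of_forall fun x => by positivity)
      integrableOn_exp_neg_half_sq ?_
    filter_upwards [ae_restrict_mem measurableSet_Ioi] with x hx
    refine mul_le_of_le_one_left (Real.exp_pos _).le (Real.exp_le_one_iff.2 ?_)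
    have := mul_nonneg hβ (le_of_lt hx)
    linarith
  have hpi : 0 < √(2 * Real.pi) := by positivity
  rw [gaussianReal_abs_gt β hβ, gaussianReal_Ioi]
  calc _ ≤ 2 * ((√(2 * Real.pi))⁻¹ * Real.exp (-β ^ 2 / 2) * (√(2 * Real.pi) / 2)) := by gcongr
    _ = _ := by field_simp

/-- Mills' bound. -/
lemma gaussianReal_tail_le_mills (β : ℝ) (hβ : 0 < β) :
    (gaussianReal 0 1).real {x | β < |x|} ≤ √(2 / Real.pi) / β * Real.exp (-β ^ 2 / 2) := by
  have h : ∫ x in Set.Ioi (0 : ℝ), Real.exp (-β * x) * Real.exp (-(1 / 2) * x ^ 2) ≤ 1 / β := by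
    have : 1 / β = ∫ x in Set.Ioi (0 : ℝ), Real.exp (-β * x) := by
      rw [integral_exp_mul_Ioi (by linarith)]
      simp
    rw [this]
    refine integral_mono_of_nonneg (Filter.Eventually.of_forall fun x => by positivity)
      (integrableOn_exp_mul_Ioi (by linarith) 0) ?_
    filter_upwards with x
    refine mul_le_of_le_one_right (Real.exp_pos _).le (Real.exp_le_one_iff.2 ?_)
    nlinarith [sq_nonneg x]
  have hpi : 0 < √(2 * Real.pi) := by positivity
  have hc : √(2 / Real.pi) = 2 * (√(2 * Real.pi))⁻¹ := by
    rw [Real.sqrt_eq_iff_mul_self_eq (by positivity) (by positivity)]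
    have := Real.mul_self_sqrt (show 0 ≤ 2 * Real.pi by positivity)
    field_simp
    rw [Real.sq_sqrt (by positivity)]
  rw [gaussianReal_abs_gt β hβ.le, gaussianReal_Ioi, hc]
  calc _ ≤ 2 * ((√(2 * Real.pi))⁻¹ * Real.exp (-β ^ 2 / 2) * (1 / β)) := by gcongr
    _ = _ := by field_simp

lemma gaussianReal_tail_scale (v : ℝ≥0) (β : ℝ) :
    (gaussianReal 0 v).real {x | β * √v < |x|} ≤ (gaussianReal 0 1).real {x | β < |x|} := by
  rcases eq_or_ne v 0 with rfl | hv
  · simp [measureReal_def]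
  · have hs : 0 < √(v : ℝ) := Real.sqrt_pos.2 (by positivity)
    have hmap : gaussianReal 0 v = (gaussianReal 0 1).map (√(v : ℝ) * ·) := by
      rw [gaussianReal_map_const_mul]
      congr 1
      · simp
      · ext
        simp
    have hmeas : MeasurableSet {x : ℝ | β * √v < |x|} :=
      measurableSet_lt measurable_const measurable_id.abs
    rw [hmap, map_measureReal_apply (by fun_prop) hmeas]
    refine le_of_eq ?_
    congr 1
    ext x
    simp only [Set.mem_preimage, Set.mem_ofPred_eq, abs_mul, abs_of_pos hs]
    rw [mul_comm β, mul_lt_mul_iff_right₀ hs]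

/-! ### Separated sets and volume -/

section Packing

open Metric Module
open scoped ENNReal Function

variable {E : Type*} [NormedAddCommGroup E] [NormedSpace ℝ E] [FiniteDimensional ℝ E]

/-- The balls of radius `τ / 2` around the points of a `τ`-separated set are disjoint; comparing
volumes bounds its cardinality. -/
lemma card_le_of_separated_closedBall (s : Finset E) (c : E) {ρ τ : ℝ} (hτ : 0 < τ) (hρ : 0 ≤ ρ)
    (hs : ∀ x ∈ s, dist x c ≤ ρ) (h : ∀ x ∈ s, ∀ y ∈ s, x ≠ y → τ ≤ dist x y) :
    (s.card : ℝ) ≤ (2 * ρ / τ + 1) ^ finrank ℝ E := by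
  borelize E
  let μ : Measure E := Measure.addHaar
  have hτ2 : 0 < τ / 2 := by positivity
  have hR : 0 < ρ + τ / 2 := by positivity
  have D : Set.Pairwise (s : Set E) (Disjoint on fun x => ball x (τ / 2)) := by
    rintro x hx y hy hxy
    apply ball_disjoint_ball
    linarith [h x hx y hy hxy]
  have hsub : (⋃ x ∈ s, ball x (τ / 2)) ⊆ ball c (ρ + τ / 2) := by
    refine Set.iUnion₂_subset fun x hx => ball_subset_ball' ?_
    linarith [hs x hx]
  have I : (s.card : ℝ≥0∞) * ENNReal.ofReal ((τ / 2) ^ finrank ℝ E) * μ (ball 0 1) ≤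
      ENNReal.ofReal ((ρ + τ / 2) ^ finrank ℝ E) * μ (ball 0 1) :=
    calc
      _ = μ (⋃ x ∈ s, ball x (τ / 2)) := by
        rw [measure_biUnion_finset D fun c _ => measurableSet_ball]
        simp only [μ.addHaar_ball_of_pos _ hτ2]
        simp only [Finset.sum_const, nsmul_eq_mul, mul_assoc]
      _ ≤ μ (ball c (ρ + τ / 2)) := measure_mono hsub
      _ = _ := by simp only [μ.addHaar_ball_of_pos _ hR]
  have J := (ENNReal.mul_le_mul_iff_left (measure_ball_pos μ _ zero_lt_one).ne'
    measure_ball_lt_top.ne).1 I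
  have J' := ENNReal.toReal_le_of_le_ofReal (by positivity) J
  rw [ENNReal.toReal_mul, ENNReal.toReal_natCast, ENNReal.toReal_ofReal (by positivity)] at J'
  have : 2 * ρ / τ + 1 = (ρ + τ / 2) / (τ / 2) := by field_simp
  rw [this, div_pow, le_div_iff₀ (by positivity)]
  exact J'

/-- A maximal `τ`-separated subset is a net. -/
lemma exists_net_of_subset_closedBall (K : Set E) (c : E) {ρ τ : ℝ} (hτ : 0 < τ) (hρ : 0 ≤ ρ)
    (hK : K ⊆ closedBall c ρ) :
    ∃ T : Finset E, (T : Set E) ⊆ K ∧ (∀ p ∈ K, ∃ q ∈ T, dist p q ≤ τ) ∧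
      (T.card : ℝ) ≤ (2 * ρ / τ + 1) ^ finrank ℝ E := by
  lift τ to ℝ≥0 using hτ.le
  have hsep : ∀ C : Set E, IsSeparated τ C → ∀ x ∈ C, ∀ y ∈ C, x ≠ y → (τ : ℝ) ≤ dist x y := by
    intro C hC x hx y hy hxy
    have : (τ : ℝ≥0∞) < edist x y := hC hx hy hxy
    rw [edist_nndist] at this
    exact_mod_cast this.le
  set B : ℝ := (2 * ρ / τ + 1) ^ finrank ℝ E with hB
  have hB0 : 0 ≤ B := by positivity
  have hpack : packingNumber τ K ≤ (⌊B⌋₊ : ℕ∞) := by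
    refine iSup₂_le fun C hCK => iSup_le fun hC => ?_
    by_contra! hlt
    obtain ⟨D, hDC, hD⟩ := Set.exists_subset_encard_eq (Order.add_one_le_of_lt hlt)
    have hfin : D.Finite := Set.finite_of_encard_eq_coe (k := ⌊B⌋₊ + 1) (by exact_mod_cast hD)
    have hcard := card_le_of_separated_closedBall hfin.toFinset c hτ hρ
      (fun x hx => hK (hCK (hDC (by simpa using hx))))
      (fun x hx y hy => hsep C hC x (hDC (by simpa using hx)) y (hDC (by simpa using hy)))
    rw [← hB] at hcard
    have h1 : hfin.toFinset.card ≤ ⌊B⌋₊ := Nat.le_floor hcard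
    rw [hfin.encard_eq_coe_toFinset_card] at hD
    have h2 : hfin.toFinset.card = ⌊B⌋₊ + 1 := by exact_mod_cast hD
    omega
  have hne : packingNumber τ K ≠ ⊤ := ne_top_of_le_ne_top (ENat.natCast_ne_top _) hpack
  have hfin : (maximalSeparatedSet τ K).Finite := by
    rw [← Set.encard_ne_top_iff, encard_maximalSeparatedSet hne]
    exact hne
  refine ⟨hfin.toFinset, by simpa using maximalSeparatedSet_subset, fun p hp => ?_, ?_⟩
  · obtain ⟨q, hq, hpq⟩ := isCover_maximalSeparatedSet hne hp
    refine ⟨q, by simpa using hq, ?_⟩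
    have : edist p q ≤ τ := hpq
    rw [edist_nndist] at this
    exact_mod_cast this
  · refine card_le_of_separated_closedBall _ c hτ hρ
      (fun x hx => hK (maximalSeparatedSet_subset (by simpa using hx)))
      (fun x hx y hy => hsep _ isSeparated_maximalSeparatedSet x (by simpa using hx) y
        (by simpa using hy))

end Packing

/-- A compact set of diameter `r` lies in a ball of radius `(√3 / 2) r`: centre it at the midpoint
of two points at maximal distance. -/
lemma exists_subset_closedBall_of_diam {E : Type*} [NormedAddCommGroup E] [InnerProductSpace ℝ E]
    (K : Set E) (hK : IsCompact K) (hne : K.Nonempty) :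
    ∃ c, K ⊆ Metric.closedBall c (√3 / 2 * Metric.diam K) := by
  obtain ⟨⟨x, y⟩, ⟨hx, hy⟩, hmax⟩ := (hK.prod hK).exists_isMaxOn (hne.prod hne)
    (f := fun z : E × E => dist z.1 z.2) (by fun_prop)
  have hd : dist x y = Metric.diam K := by
    refine le_antisymm (Metric.dist_le_diam_of_mem hK.isBounded hx hy)
      (Metric.diam_le_of_forall_dist_le dist_nonneg fun a ha b hb => ?_)
    exact hmax (Set.mk_mem_prod ha hb)
  refine ⟨midpoint ℝ x y, fun p hp => ?_⟩
  rw [Metric.mem_closedBall]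
  have h1 : dist p x ≤ Metric.diam K := Metric.dist_le_diam_of_mem hK.isBounded hp hx
  have h2 : dist p y ≤ Metric.diam K := Metric.dist_le_diam_of_mem hK.isBounded hp hy
  have happ := EuclideanGeometry.dist_sq_add_dist_sq_eq_two_mul_dist_midpoint_sq_add_half_dist_sq
    p x y
  rw [hd] at happ
  have hr : 0 ≤ Metric.diam K := Metric.diam_nonneg
  refine abs_le_of_sq_le_sq' ?_ (by positivity) |>.2
  rw [mul_pow, div_pow, Real.sq_sqrt (by norm_num)]
  nlinarith [mul_self_le_mul_self dist_nonneg h1, mul_self_le_mul_self dist_nonneg h2]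

/-! ### Grids and convex hulls -/

/-- The midpoints of `N` equal cells of `[0, r]`. -/
lemma exists_cell_midpoint {r y : ℝ} {N : ℕ} (hN : 0 < N) (h0 : 0 ≤ y) (hr : y ≤ r) :
    ∃ t : Fin N, |y - (2 * (t : ℝ) + 1) * (r / (2 * N))| ≤ r / (2 * N) := by
  have hN' : (0 : ℝ) < N := by exact_mod_cast hN
  rcases (h0.trans hr).eq_or_lt with h | hrpos
  · have hy : y = 0 := by linarith
    exact ⟨⟨0, hN⟩, by simp [hy, ← h]⟩
  have hcell : r / (2 * N) * (2 * N) = r := by field_simp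
  set h := r / (2 * N) with hh
  have hpos : 0 < h := by positivity
  rcases hr.eq_or_lt with heq | hlt
  · refine ⟨⟨N - 1, by omega⟩, ?_⟩
    have : ((N - 1 : ℕ) : ℝ) = N - 1 := by
      rw [Nat.cast_sub (by omega)]
      simp
    simp only [this]
    rw [abs_le]
    constructor <;> nlinarith
  · have hle := Nat.floor_le (show 0 ≤ y / (2 * h) by positivity)
    have hlt' := Nat.lt_floor_add_one (y / (2 * h))
    rw [le_div_iff₀ (by positivity)] at hle
    rw [div_lt_iff₀ (by positivity)] at hlt'
    refine ⟨⟨⌊y / (2 * h)⌋₊, ?_⟩, ?_⟩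
    · rw [Nat.floor_lt (by positivity), div_lt_iff₀ (by positivity)]
      linarith
    · rw [abs_le]
      constructor <;> nlinarith

/-- A bounded set of diameter `r` is covered by `N ^ d` balls of radius `τ`, the balls around the
cells of a grid with `N` cells per axis, as soon as the cells have diagonal at most `2 * τ`. -/
lemma exists_grid {d : ℕ} (K : Set (Input d)) (hK : Bornology.IsBounded K) {τ : ℝ} (hτ : 0 < τ)
    {N : ℕ} (hN : 0 < N) (h : Metric.diam K * √d / (2 * τ) ≤ N) :
    ∃ T : Finset (Input d), (∀ p ∈ K, ∃ q ∈ T, dist p q ≤ τ) ∧ T.card ≤ N ^ d := by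
  classical
  rcases K.eq_empty_or_nonempty with rfl | hne
  · exact ⟨∅, by simp, by simp⟩
  set r := Metric.diam K with hr
  have hr0 : 0 ≤ r := Metric.diam_nonneg
  have hN' : (0 : ℝ) < N := by exact_mod_cast hN
  have hcoord : ∀ (i : Fin d) (p q : Input d), p ∈ K → q ∈ K → p i - q i ≤ r := by
    intro i p q hp hq
    have h1 : ‖(p - q) i‖ ≤ ‖p - q‖ := PiLp.norm_apply_le (p - q) i
    rw [← dist_eq_norm] at h1
    exact (le_abs_self _).trans (h1.trans (Metric.dist_le_diam_of_mem hK hp hq))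
  let lo : Fin d → ℝ := fun i => sInf ((fun p : Input d => p i) '' K)
  have hbdd : ∀ i, BddBelow ((fun p : Input d => p i) '' K) := by
    intro i
    obtain ⟨p₀, hp₀⟩ := hne
    refine ⟨p₀ i - r, ?_⟩
    rintro _ ⟨q, hq, rfl⟩
    have := hcoord i p₀ q hp₀ hq
    linarith
  have hlo : ∀ i, ∀ p ∈ K, 0 ≤ p i - lo i ∧ p i - lo i ≤ r := by
    intro i p hp
    constructor
    · exact sub_nonneg.2 (csInf_le (hbdd i) ⟨p, hp, rfl⟩)
    · have : p i - r ≤ lo i := by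
        refine le_csInf (hne.image _) ?_
        rintro _ ⟨q, hq, rfl⟩
        have := hcoord i p q hp hq
        linarith
      linarith
  let ctr : (Fin d → Fin N) → Input d := fun t =>
    WithLp.toLp 2 fun i => lo i + (2 * ((t i : ℕ) : ℝ) + 1) * (r / (2 * N))
  refine ⟨Finset.univ.image ctr, fun p hp => ?_, ?_⟩
  · choose t ht using fun i => exists_cell_midpoint hN (hlo i p hp).1 (hlo i p hp).2
    refine ⟨ctr t, Finset.mem_image_of_mem _ (Finset.mem_univ _), ?_⟩
    rw [EuclideanSpace.dist_eq]
    refine Real.sqrt_le_iff.2 ⟨hτ.le, ?_⟩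
    have hi : ∀ i, dist (p i) (ctr t i) ^ 2 ≤ (r / (2 * N)) ^ 2 := by
      intro i
      rw [Real.dist_eq]
      refine pow_le_pow_left₀ (abs_nonneg _) ?_ 2
      have := ht i
      rwa [sub_sub] at this
    refine (Finset.sum_le_sum fun i _ => hi i).trans ?_
    rw [Finset.sum_const, Finset.card_univ, Fintype.card_fin, nsmul_eq_mul]
    rw [div_le_iff₀ (by positivity)] at h
    have h2 : √d * (r / (2 * N)) ≤ τ := by
      rw [← mul_div_assoc, div_le_iff₀ (by positivity)]
      linarith
    calc (d : ℝ) * (r / (2 * N)) ^ 2 = (√d * (r / (2 * N))) ^ 2 := by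
          rw [mul_pow, Real.sq_sqrt (by positivity)]
      _ ≤ τ ^ 2 := pow_le_pow_left₀ (by positivity) h2 2
  · refine Finset.card_image_le.trans ?_
    simp

/-- By Carathéodory's theorem the hull is a finite union of continuous images of products of a
simplex and a power of the set. -/
lemma isCompact_convexHull {E : Type*} [NormedAddCommGroup E] [NormedSpace ℝ E]
    [FiniteDimensional ℝ E] {K : Set E} (hK : IsCompact K) : IsCompact (convexHull ℝ K) := by
  let F : (N : ℕ) → ((Fin N → ℝ) × (Fin N → E)) → E := fun N z => ∑ i, z.1 i • z.2 i
  have hunion : convexHull ℝ K = ⋃ N ∈ Finset.range (Module.finrank ℝ E + 2),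
      F N '' (stdSimplex ℝ (Fin N) ×ˢ Set.univ.pi fun _ => K) := by
    refine Set.Subset.antisymm (fun x hx => ?_) ?_
    · obtain ⟨ι, _, z, w, hz, hind, hw, hw1, rfl⟩ := eq_pos_convex_span_of_mem_convexHull hx
      have hcard : Fintype.card ι < Module.finrank ℝ E + 2 := by
        have := hind.card_le_finrank_succ
        have := Submodule.finrank_le (vectorSpan ℝ (Set.range z))
        omega
      let e := Fintype.equivFin ι
      refine Set.mem_biUnion (Finset.mem_coe.2 (Finset.mem_range.2 hcard))
        ⟨(w ∘ e.symm, z ∘ e.symm), ⟨⟨fun i => (hw _).le, ?_⟩, fun i _ => hz ⟨_, rfl⟩⟩, ?_⟩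
      · rw [← hw1]
        exact e.symm.sum_comp w
      · exact e.symm.sum_comp fun i => w i • z i
    · refine Set.iUnion₂_subset fun N _ => ?_
      rintro _ ⟨⟨w, z⟩, ⟨⟨hw, hw1⟩, hz⟩, rfl⟩
      exact (convex_convexHull ℝ K).sum_mem (fun i _ => hw i) hw1
        fun i _ => subset_convexHull ℝ K (hz i (Set.mem_univ i))
  rw [hunion]
  refine Finset.isCompact_biUnion _ fun N _ => IsCompact.image ?_ (by fun_prop)
  exact (isCompact_stdSimplex ℝ _).prod (isCompact_univ_pi fun _ => hK)

/-- The metric projection to the closed convex hull brings every point closer to the points of the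
set, so the points of a net can be taken in the convex hull. -/
lemma exists_net_in_convexHull {E : Type*} [NormedAddCommGroup E] [InnerProductSpace ℝ E]
    [FiniteDimensional ℝ E] (K : Set E) (hK : IsCompact K) {τ : ℝ} (T : Finset E)
    (hT : ∀ p ∈ K, ∃ q ∈ T, dist p q ≤ τ) :
    ∃ T' : Finset E, (T' : Set E) ⊆ convexHull ℝ K ∧ (∀ p ∈ K, ∃ q ∈ T', dist p q ≤ τ) ∧
      T'.card ≤ T.card := by
  classical
  rcases K.eq_empty_or_nonempty with rfl | hne
  · exact ⟨∅, by simp, by simp, by simp⟩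
  have hconv : Convex ℝ (convexHull ℝ K) := convex_convexHull ℝ K
  have hproj : ∀ u : E, ∃ v ∈ convexHull ℝ K, ∀ p ∈ K, dist p v ≤ dist p u := by
    intro u
    obtain ⟨v, hv, hmin⟩ := exists_norm_eq_iInf_of_complete_convex hne.convexHull
      (isCompact_convexHull hK).isComplete hconv u
    rw [norm_eq_iInf_iff_real_inner_le_zero hconv hv] at hmin
    refine ⟨v, hv, fun p hp => ?_⟩
    have h1 := hmin p (subset_convexHull ℝ K hp)
    have h2 : ‖p - u‖ ^ 2 = ‖p - v‖ ^ 2 - 2 * inner ℝ (u - v) (p - v) + ‖u - v‖ ^ 2 := by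
      have : p - u = (p - v) - (u - v) := by abel
      rw [this, norm_sub_sq_real, real_inner_comm]
    rw [dist_eq_norm, dist_eq_norm]
    refine abs_le_of_sq_le_sq' ?_ (norm_nonneg _) |>.2
    nlinarith [sq_nonneg ‖u - v‖]
  choose π hπ hd using hproj
  refine ⟨T.image π, ?_, fun p hp => ?_, Finset.card_image_le⟩
  · intro x hx
    obtain ⟨u, -, rfl⟩ := Finset.mem_image.1 (Finset.mem_coe.1 hx)
    exact hπ u
  · obtain ⟨q, hq, hpq⟩ := hT p hp
    exact ⟨π q, Finset.mem_image_of_mem _ hq, (hd q p hp).trans hpq⟩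

/-! ### The number of points of a net -/

lemma one_le_cellsPerAxis (d : ℕ) (r τ : ℝ) : 1 ≤ cellsPerAxis d r τ := by
  unfold cellsPerAxis
  split_ifs with h
  · linarith
  · exact le_max_left _ _

/-- In dimension at most `13`, rounding `κ` up to an integer costs at most the factor
`(7 / 6) ^ d`. -/
lemma natCeil_pow_sq_le {d : ℕ} (hd1 : 1 ≤ d) (hd : d ≤ 13) {κ : ℝ} (hκ : 6 ≤ κ) :
    ((⌈κ⌉₊ : ℝ) ^ d) ^ 2 ≤ (κ ^ d) ^ 2 * (9 / 2 * d) := by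
  have hc : (⌈κ⌉₊ : ℝ) ≤ 7 / 6 * κ := by
    have := Nat.ceil_lt_add_one (show 0 ≤ κ by linarith)
    linarith
  have hnum : ((7 / 6 : ℝ) ^ d) ^ 2 ≤ 9 / 2 * d := by
    interval_cases d <;> norm_num
  calc ((⌈κ⌉₊ : ℝ) ^ d) ^ 2 ≤ ((7 / 6 * κ) ^ d) ^ 2 := by gcongr
    _ = (κ ^ d) ^ 2 * ((7 / 6) ^ d) ^ 2 := by rw [mul_pow]; ring
    _ ≤ _ := by gcongr

/-- In dimension at least `14`, the volumetric bound is at most `κ ^ d`, up to a constant factor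
in the dimensions up to `17`. -/
lemma volumetric_pow_sq_le {d : ℕ} (hd : 14 ≤ d) {κ : ℝ} (hκ : 6 ≤ κ) :
    ((2 * √3 * κ / √d + 1) ^ d) ^ 2 ≤ (κ ^ d) ^ 2 * (9 / 2 * d) := by
  have hd' : (14 : ℝ) ≤ d := by exact_mod_cast hd
  have hd0 : 0 < √(d : ℝ) := Real.sqrt_pos.2 (by linarith)
  have h3 : √3 ≤ 1.7321 := Real.sqrt_le_iff.2 ⟨by norm_num, by norm_num⟩
  -- The base is at most `κ * (2 * √3 / √d + 1 / 6)`.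
  have hbase : ∀ c ρ : ℝ, 0 < c → c ≤ √d → 2 * 1.7321 ≤ (ρ - 1 / 6) * c →
      2 * √3 * κ / √d + 1 ≤ ρ * κ := by
    intro c ρ hc hcd hρ
    have h1 : 2 * √3 * κ / √d ≤ (ρ - 1 / 6) * κ := by
      rw [div_le_iff₀ hd0]
      have hρ' : 0 ≤ ρ - 1 / 6 := by
        by_contra! hneg
        nlinarith
      have : (ρ - 1 / 6) * c ≤ (ρ - 1 / 6) * √d := by gcongr
      nlinarith
    linarith
  have hκd : 0 ≤ (κ ^ d) ^ 2 := by positivity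
  rcases le_or_gt 18 d with h18 | h18
  · have h18' : (18 : ℝ) ≤ d := by exact_mod_cast h18
    -- `4.24 ≤ √18`
    have hb := hbase 4.24 1 (by norm_num) (Real.le_sqrt_of_sq_le (by norm_num; linarith))
      (by norm_num)
    rw [one_mul] at hb
    calc ((2 * √3 * κ / √d + 1) ^ d) ^ 2 ≤ (κ ^ d) ^ 2 := by gcongr
      _ ≤ _ := le_mul_of_one_le_right hκd (by linarith)
  · -- `3.74 ≤ √14`
    have hb := hbase 3.74 1.1 (by norm_num) (Real.le_sqrt_of_sq_le (by norm_num; linarith))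
      (by norm_num)
    have hnum : ((1.1 : ℝ) ^ d) ^ 2 ≤ 9 / 2 * d := by
      interval_cases d <;> norm_num
    calc ((2 * √3 * κ / √d + 1) ^ d) ^ 2 ≤ ((1.1 * κ) ^ d) ^ 2 := by gcongr
      _ = (κ ^ d) ^ 2 * (1.1 ^ d) ^ 2 := by rw [mul_pow]; ring
      _ ≤ _ := by gcongr

/-- The covering bound behind `φ`. For non-integral `κ ≥ 6` a grid may need more than `κ ^ d`
points; the excess factor `√(9 d / 2)` is made up for by Mills' bound on the Gaussian tail. -/
lemma exists_net_card_le {d : ℕ} (K : Set (Input d)) (hK : IsCompact K) {τ : ℝ} (hτ : 0 < τ) :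
    ∃ T : Finset (Input d), (T : Set (Input d)) ⊆ convexHull ℝ K ∧
      (∀ p ∈ K, ∃ q ∈ T, dist p q ≤ τ) ∧
      ((T.card : ℝ) ≤ cellsPerAxis d (Metric.diam K) τ ^ d ∨
        (6 ≤ cellsPerAxis d (Metric.diam K) τ ∧ 1 ≤ d ∧
          (T.card : ℝ) ^ 2 ≤ (cellsPerAxis d (Metric.diam K) τ ^ d) ^ 2 * (9 / 2 * d))) := by
  rcases K.eq_empty_or_nonempty with rfl | hne
  · refine ⟨∅, by simp, by simp, Or.inl ?_⟩
    have := one_le_cellsPerAxis d (Metric.diam (∅ : Set (Input d))) τ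
    simp only [Finset.card_empty, Nat.cast_zero]
    positivity
  by_cases h6 : 6 ≤ Metric.diam K * √d / (2 * τ)
  · have hκ : cellsPerAxis d (Metric.diam K) τ = Metric.diam K * √d / (2 * τ) := if_pos h6
    rw [hκ]
    set κ := Metric.diam K * √d / (2 * τ) with hκdef
    have hd1 : 1 ≤ d := by
      by_contra! hd0
      have : d = 0 := by omega
      subst this
      simp at hκdef
      linarith
    rcases le_or_gt d 13 with hd | hd
    · obtain ⟨T₀, hT₀, hcard₀⟩ := exists_grid K hK.isBounded hτ (N := ⌈κ⌉₊)
        (Nat.ceil_pos.2 (by linarith)) (Nat.le_ceil _)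
      obtain ⟨T, hsub, hT, hcard⟩ := exists_net_in_convexHull K hK T₀ hT₀
      refine ⟨T, hsub, hT, Or.inr ⟨h6, hd1, ?_⟩⟩
      refine le_trans ?_ (natCeil_pow_sq_le hd1 hd h6)
      have : (T.card : ℝ) ≤ (⌈κ⌉₊ : ℝ) ^ d := by exact_mod_cast hcard.trans hcard₀
      gcongr
    · obtain ⟨c, hc⟩ := exists_subset_closedBall_of_diam K hK hne
      have hdiam : 0 ≤ Metric.diam K := Metric.diam_nonneg
      obtain ⟨T, hsub, hT, hcard⟩ := exists_net_of_subset_closedBall K c hτ (by positivity) hc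
      refine ⟨T, hsub.trans (subset_convexHull ℝ K), hT, Or.inr ⟨h6, hd1, ?_⟩⟩
      refine le_trans ?_ (volumetric_pow_sq_le (by omega) h6)
      have hd0 : 0 < √(d : ℝ) := Real.sqrt_pos.2 (by exact_mod_cast hd1)
      have heq : 2 * (√3 / 2 * Metric.diam K) / τ = 2 * √3 * κ / √d := by
        rw [hκdef]
        field_simp
      rw [heq, finrank_euclideanSpace_fin] at hcard
      gcongr
  · have hκ : cellsPerAxis d (Metric.diam K) τ =
        ((max 1 ⌈Metric.diam K * √d / (2 * τ)⌉₊ : ℕ) : ℝ) := by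
      rw [cellsPerAxis, if_neg h6]
      simp
    obtain ⟨T₀, hT₀, hcard₀⟩ := exists_grid K hK.isBounded hτ
      (N := max 1 ⌈Metric.diam K * √d / (2 * τ)⌉₊) (by simp)
      ((Nat.le_ceil _).trans (by exact_mod_cast le_max_right _ _))
    obtain ⟨T, hsub, hT, hcard⟩ := exists_net_in_convexHull K hK T₀ hT₀
    refine ⟨T, hsub, hT, Or.inl ?_⟩
    rw [hκ]
    exact_mod_cast hcard.trans hcard₀

/-! ### Regrouping independent families -/

section Independence

variable {Ω ι : Type*} {mΩ : MeasurableSpace Ω} {P : Measure Ω}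

/-- Grouping an independent family indexed by pairs gives independent families; this is the
converse of `iIndepFun_uncurry`. -/
lemma iIndepFun_curry {κ : ι → Type*} {𝓧 : (i : ι) → κ i → Type*}
    {m𝓧 : ∀ i j, MeasurableSpace (𝓧 i j)} {X : (i : ι) → (j : κ i) → Ω → 𝓧 i j}
    (mX : ∀ i j, Measurable (X i j))
    (h : iIndepFun (fun (p : (i : ι) × (κ i)) ω ↦ X p.1 p.2 ω) P) :
    iIndepFun (fun i ω ↦ (X i · ω)) P := by
  have := h.isProbabilityMeasure
  have : ∀ i j, IsProbabilityMeasure (P.map (X i j)) :=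
    fun i j ↦ Measure.isProbabilityMeasure_map (mX i j).aemeasurable
  have hi : ∀ i, iIndepFun (X i) P := fun i ↦
    h.precomp (g := fun j : κ i ↦ (⟨i, j⟩ : (i : ι) × κ i)) sigma_mk_injective
  have hcurry : (MeasurableEquiv.piCurry 𝓧) ∘ (fun ω p ↦ X p.1 p.2 ω) = fun ω i j ↦ X i j ω := by
    ext; simp [Sigma.curry]
  rw [iIndepFun_iff_map_fun_eq_infinitePi_map (by fun_prop)] at h ⊢
  rw [← hcurry, ← Measure.map_map (by fun_prop) (by fun_prop), h,
    Measure.infinitePi_map_piCurry (fun i j ↦ P.map (X i j))]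
  congrm Measure.infinitePi fun i ↦ ?_
  rw [(iIndepFun_iff_map_fun_eq_infinitePi_map (by fun_prop)).1 (hi i)]

lemma iIndepFun_prodMk {β γ : ι → Type*} [∀ i, MeasurableSpace (β i)]
    [∀ i, MeasurableSpace (γ i)] {F : (i : ι) → Ω → β i} {Z : (i : ι) → Ω → γ i}
    (mF : ∀ i, Measurable (F i)) (mZ : ∀ i, Measurable (Z i))
    (hF : iIndepFun F P) (hZ : iIndepFun Z P)
    (hFZ : IndepFun (fun ω i ↦ F i ω) (fun ω i ↦ Z i ω) P) :
    iIndepFun (fun i ω ↦ (F i ω, Z i ω)) P := by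
  rw [iIndepFun_iff_iIndep]
  refine iIndepSets.iIndep (fun i ↦ ((mF i).prodMk (mZ i)).comap_le)
    (fun i ↦ {s | ∃ A B, MeasurableSet A ∧ MeasurableSet B ∧ F i ⁻¹' A ∩ Z i ⁻¹' B = s})
    (fun i ↦ ?_) (fun i ↦ ?_) ?_
  · rintro _ ⟨A, B, hA, hB, rfl⟩ _ ⟨A', B', hA', hB', rfl⟩ -
    refine ⟨A ∩ A', B ∩ B', hA.inter hA', hB.inter hB', ?_⟩
    ext ω
    simp only [Set.mem_inter_iff, Set.mem_preimage]
    tauto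
  · rw [← generateFrom_prod, MeasurableSpace.comap_generateFrom]
    congr 1
    ext s
    constructor
    · rintro ⟨_, ⟨A, hA, B, hB, rfl⟩, rfl⟩
      exact ⟨A, B, hA, hB, rfl⟩
    · rintro ⟨A, B, hA, hB, rfl⟩
      exact ⟨A ×ˢ B, ⟨A, hA, B, hB, rfl⟩, rfl⟩
  · rw [iIndepSets_iff]
    intro s f hf
    choose! A B hA hB hAB using hf
    have hinter : ⋂ i ∈ s, f i = (fun ω i ↦ F i ω) ⁻¹' ((s : Set ι).pi A) ∩
        (fun ω i ↦ Z i ω) ⁻¹' ((s : Set ι).pi B) := by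
      ext ω
      simp only [Set.mem_iInter, Set.mem_inter_iff, Set.mem_preimage, Set.mem_pi, Finset.mem_coe,
        ← forall_and]
      refine forall₂_congr fun i hi ↦ ?_
      rw [← hAB i hi]
      rfl
    have hpreF : (fun ω i ↦ F i ω) ⁻¹' ((s : Set ι).pi A) = ⋂ i ∈ s, F i ⁻¹' A i := by
      ext ω
      simp [Set.mem_pi]
    have hpreZ : (fun ω i ↦ Z i ω) ⁻¹' ((s : Set ι).pi B) = ⋂ i ∈ s, Z i ⁻¹' B i := by
      ext ω
      simp [Set.mem_pi]
    rw [hinter, hFZ.measure_inter_preimage_eq_mul _ _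
      (MeasurableSet.pi s.countable_toSet hA) (MeasurableSet.pi s.countable_toSet hB),
      hpreF, hpreZ, hF.measure_inter_preimage_eq_mul s hA,
      hZ.measure_inter_preimage_eq_mul s hB, ← Finset.prod_mul_distrib]
    refine Finset.prod_congr rfl fun i hi ↦ ?_
    rw [← hAB i hi]
    refine (IndepFun.measure_inter_preimage_eq_mul ?_ _ _ (hA i hi) (hB i hi)).symm
    exact hFZ.comp (measurable_pi_apply i) (measurable_pi_apply i)

end Independence

/-! ### The residual of the posterior mean -/

section Posterior

variable {Ω : Type*} {mΩ : MeasurableSpace Ω} {P : Measure Ω} {d M : ℕ}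
  {k : Input d → Input d → ℝ} {g : Input d → Ω → ℝ} {X : Fin M → Input d} {σo : ℝ}

lemma postMean_eq_sum (Y : Fin M → ℝ) (p : Input d) :
    postMean k X σo Y p = ∑ a, (kVec k X p ᵥ* (noisyGram k X σo)⁻¹) a * Y a := by
  rw [postMean, Matrix.dotProduct_mulVec]
  rfl

lemma IsCenteredGP.symm (hg : IsCenteredGP k g P) (p q : Input d) : k p q = k q p := by
  rw [← hg.cov_eq, ← hg.cov_eq, covariance_comm]

lemma IsCenteredGP.memLp (hg : IsCenteredGP k g P) (p : Input d) : MemLp (g p) 2 P :=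
  (hg.gaussian.hasGaussianLaw_eval p).memLp_two

lemma IsCenteredGP.gram_nonneg (hg : IsCenteredGP k g P) (v : Fin M → ℝ) :
    0 ≤ v ⬝ᵥ (Matrix.of (fun a b => k (X a) (X b)) *ᵥ v) := by
  have := hg.gaussian.isProbabilityMeasure
  have h : Var[fun ω => ∑ a, v a * g (X a) ω; P] =
      v ⬝ᵥ (Matrix.of (fun a b => k (X a) (X b)) *ᵥ v) := by
    rw [variance_fun_sum fun a => (hg.memLp (X a)).const_mul (v a)]
    simp only [dotProduct, Matrix.mulVec, Matrix.of_apply, Finset.mul_sum,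
      covariance_const_mul_left, covariance_const_mul_right, hg.cov_eq]
    refine Finset.sum_congr rfl fun a _ => Finset.sum_congr rfl fun b _ => ?_
    ring
  rw [← h]
  exact variance_nonneg _ _

lemma IsCenteredGP.isUnit_det_noisyGram (hg : IsCenteredGP k g P) (hσo : 0 < σo) :
    IsUnit (noisyGram k X σo).det := by
  rw [isUnit_iff_ne_zero]
  intro hdet
  obtain ⟨v, hv, hKv⟩ := Matrix.exists_mulVec_eq_zero_iff.2 hdet
  have h0 : v ⬝ᵥ (noisyGram k X σo *ᵥ v) = 0 := by rw [hKv, dotProduct_zero]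
  rw [noisyGram, Matrix.add_mulVec, dotProduct_add, Matrix.smul_mulVec, Matrix.one_mulVec,
    dotProduct_smul, smul_eq_mul] at h0
  have h1 := hg.gram_nonneg (X := X) v
  have h2 : 0 < v ⬝ᵥ v := by
    have : v ⬝ᵥ v ≠ 0 := fun h => hv (dotProduct_self_eq_zero.1 h)
    exact lt_of_le_of_ne (Finset.sum_nonneg fun i _ => mul_self_nonneg (v i)) this.symm
  have : 0 < σo ^ 2 * (v ⬝ᵥ v) := by positivity
  linarith

variable {z : Fin M → Ω → ℝ}

/-- The residual of the posterior mean is a linear combination of jointly Gaussian variables. -/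
lemma IsCenteredGP.hasGaussianLaw_sub_postMean (hg : IsCenteredGP k g P)
    (hzlaw : ∀ a, HasGaussianLaw (z a) P) (hz : iIndepFun z P)
    (hgz : IndepFun (fun ω p => g p ω) (fun ω a => z a ω) P) (q : Input d) :
    HasGaussianLaw (fun ω => g q ω - postMean k X σo (fun a => g (X a) ω + z a ω) q) P := by
  classical
  let I : Finset (Input d) := insert q (Finset.univ.image X)
  have hq : q ∈ I := Finset.mem_insert_self _ _
  have hX : ∀ a, X a ∈ I := fun a =>
    Finset.mem_insert_of_mem (Finset.mem_image_of_mem _ (Finset.mem_univ a))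
  have hpair : HasGaussianLaw (fun ω => (I.restrict (g · ω), fun a => z a ω)) P := by
    refine IndepFun.hasGaussianLaw (hg.gaussian.hasGaussianLaw I) (hz.hasGaussianLaw hzlaw) ?_
    exact hgz.comp (φ := I.restrict) (ψ := id) (by fun_prop) measurable_id
  let w := kVec k X q ᵥ* (noisyGram k X σo)⁻¹
  let L : ((I → ℝ) × (Fin M → ℝ)) →ₗ[ℝ] ℝ :=
    { toFun := fun u => u.1 ⟨q, hq⟩ - ∑ a, w a * (u.1 ⟨X a, hX a⟩ + u.2 a)
      map_add' := fun u v => by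
        simp only [Prod.fst_add, Prod.snd_add, Pi.add_apply, mul_add, Finset.sum_add_distrib]
        ring
      map_smul' := fun c u => by
        simp only [Prod.smul_fst, Prod.smul_snd, Pi.smul_apply, smul_eq_mul, RingHom.id_apply,
          mul_sub, Finset.mul_sum]
        congr 1
        exact Finset.sum_congr rfl fun a _ => by ring }
  have h := hpair.map_fun (LinearMap.toContinuousLinearMap L)
  simp only [postMean_eq_sum]
  exact h

lemma IsCenteredGP.integral_sub_postMean (hg : IsCenteredGP k g P)
    (hzint : ∀ a, Integrable (z a) P) (hz0 : ∀ a, ∫ ω, z a ω ∂P = 0) (q : Input d) :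
    ∫ ω, (g q ω - postMean k X σo (fun a => g (X a) ω + z a ω) q) ∂P = 0 := by
  have hgint : ∀ p, Integrable (g p) P := fun p =>
    (hg.gaussian.hasGaussianLaw_eval p).integrable
  have hint : ∀ a, Integrable
      (fun ω => (kVec k X q ᵥ* (noisyGram k X σo)⁻¹) a * (g (X a) ω + z a ω)) P :=
    fun a => ((hgint (X a)).add (hzint a)).const_mul _
  simp only [postMean_eq_sum]
  rw [integral_sub (hgint q) (integrable_finsetSum _ fun a _ => hint a), hg.mean_zero,
    integral_finsetSum _ fun a _ => hint a]
  simp [integral_const_mul, integral_add (hgint _) (hzint _), hg.mean_zero, hz0]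

/-- The posterior variance is the variance of the residual of the posterior mean. -/
lemma IsCenteredGP.variance_sub_postMean (hg : IsCenteredGP k g P) (hσo : 0 < σo)
    (hz2 : ∀ a, MemLp (z a) 2 P) (hzvar : ∀ a, Var[z a; P] = σo ^ 2) (hz : iIndepFun z P)
    (hgz : IndepFun (fun ω p => g p ω) (fun ω a => z a ω) P) (q : Input d) :
    Var[fun ω => g q ω - postMean k X σo (fun a => g (X a) ω + z a ω) q; P]
      = postVar k X σo q := by
  have := hg.gaussian.isProbabilityMeasure
  set w := kVec k X q ᵥ* (noisyGram k X σo)⁻¹ with hw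
  let y : Fin M → Ω → ℝ := fun a ω => g (X a) ω + z a ω
  have hy2 : ∀ a, MemLp (y a) 2 P := fun a => (hg.memLp (X a)).add (hz2 a)
  have hcross : ∀ p a, cov[g p, z a; P] = 0 := fun p a =>
    IndepFun.covariance_eq_zero (hgz.comp (measurable_pi_apply p) (measurable_pi_apply a))
      (hg.memLp p) (hz2 a)
  have hqy : ∀ a, cov[g q, y a; P] = kVec k X q a := fun a => by
    rw [show y a = g (X a) + z a from rfl,
      covariance_add_right (hg.memLp q) (hg.memLp (X a)) (hz2 a), hcross, hg.cov_eq, add_zero]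
    exact hg.symm _ _
  have hzz : ∀ a b, cov[z a, z b; P] = if a = b then σo ^ 2 else 0 := fun a b => by
    split_ifs with hab
    · rw [hab, covariance_self (hz2 b).aemeasurable, hzvar]
    · exact (hz.indepFun hab).covariance_eq_zero (hz2 a) (hz2 b)
  have hyy : ∀ a b, cov[y a, y b; P] = noisyGram k X σo a b := fun a b => by
    rw [show y a = g (X a) + z a from rfl, show y b = g (X b) + z b from rfl,
      covariance_add_left (hg.memLp _) (hz2 a) ((hg.memLp _).add (hz2 b)),
      covariance_add_right (hg.memLp _) (hg.memLp _) (hz2 b),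
      covariance_add_right (hz2 a) (hg.memLp _) (hz2 b), hcross, covariance_comm (z a), hcross,
      hg.cov_eq, hzz]
    simp [noisyGram, Matrix.one_apply]
  have hwy2 : ∀ a, MemLp (fun ω => w a * y a ω) 2 P := fun a => (hy2 a).const_mul _
  have hmean : (fun ω => g q ω - postMean k X σo (fun a => g (X a) ω + z a ω) q)
      = fun ω => g q ω - ∑ a, w a * y a ω := by
    simp only [postMean_eq_sum]
    rfl
  have hwK : w ᵥ* noisyGram k X σo = kVec k X q := by
    rw [hw, Matrix.vecMul_vecMul, Matrix.nonsing_inv_mul _ (hg.isUnit_det_noisyGram hσo),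
      Matrix.vecMul_one]
  have h1 : cov[g q, fun ω => ∑ a, w a * y a ω; P] = w ⬝ᵥ kVec k X q := by
    rw [covariance_fun_sum_right hwy2 (hg.memLp q)]
    simp only [covariance_const_mul_right, hqy, dotProduct]
  have h2 : Var[fun ω => ∑ a, w a * y a ω; P] = w ⬝ᵥ kVec k X q := by
    rw [variance_fun_sum hwy2]
    conv_rhs => rw [← hwK, dotProduct_comm, ← Matrix.dotProduct_mulVec]
    simp only [covariance_const_mul_left, covariance_const_mul_right, hyy, dotProduct,
      Matrix.mulVec, Finset.mul_sum]
    refine Finset.sum_congr rfl fun a _ => Finset.sum_congr rfl fun b _ => ?_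
    ring
  rw [hmean, variance_fun_sub (hg.memLp q) (memLp_finsetSum _ fun a _ => hwy2 a), h1, h2,
    ← covariance_self (hg.memLp q).aemeasurable, hg.cov_eq, postVar, Matrix.dotProduct_mulVec, ← hw]
  ring

lemma IsCenteredGP.map_sub_postMean (hg : IsCenteredGP k g P) (hσo : 0 < σo)
    (hzm : ∀ a, Measurable (z a))
    (hzlaw : ∀ a, P.map (z a) = gaussianReal 0 (Real.toNNReal (σo ^ 2))) (hz : iIndepFun z P)
    (hgz : IndepFun (fun ω p => g p ω) (fun ω a => z a ω) P) (q : Input d) :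
    P.map (fun ω => g q ω - postMean k X σo (fun a => g (X a) ω + z a ω) q)
      = gaussianReal 0 (postVar k X σo q).toNNReal := by
  have hlaw : ∀ a, HasLaw (z a) (gaussianReal 0 (Real.toNNReal (σo ^ 2))) P :=
    fun a => ⟨(hzm a).aemeasurable, hzlaw a⟩
  have hzG : ∀ a, HasGaussianLaw (z a) P := fun a => (hlaw a).hasGaussianLaw
  have hz0 : ∀ a, ∫ ω, z a ω ∂P = 0 := fun a => by
    rw [(hlaw a).integral_eq]
    exact integral_id_gaussianReal
  have hzvar : ∀ a, Var[z a; P] = σo ^ 2 := fun a => by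
    rw [(hlaw a).variance_eq, variance_id_gaussianReal, Real.coe_toNNReal _ (sq_nonneg σo)]
  rw [(hg.hasGaussianLaw_sub_postMean hzG hz hgz q).map_eq_gaussianReal,
    hg.integral_sub_postMean (fun a => (hzG a).integrable) hz0,
    hg.variance_sub_postMean hσo (fun a => (hzG a).memLp_two) hzvar hz hgz]

end Posterior

/-! ### The function `φ` and the union bound -/

section Phi

variable {d : ℕ} {r τ ε : ℝ}

lemma phi_nonneg (hε0 : 0 < ε) (hε1 : ε ≤ 1) : 0 ≤ phi d r τ ε := by
  have h1 := Real.log_nonneg (one_le_cellsPerAxis d r τ)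
  have h2 := Real.log_nonpos hε0.le hε1
  have : 0 ≤ 2 * (d : ℝ) * Real.log (cellsPerAxis d r τ) := by positivity
  unfold phi
  linarith

lemma phi_pos (hε0 : 0 < ε) (hε1 : ε < 1) : 0 < phi d r τ ε := by
  have h1 := Real.log_nonneg (one_le_cellsPerAxis d r τ)
  have h2 := Real.log_neg hε0 hε1
  have : 0 ≤ 2 * (d : ℝ) * Real.log (cellsPerAxis d r τ) := by positivity
  unfold phi
  linarith

lemma phi_le_phi_div (hε0 : 0 < ε) {n : ℕ} (hn : 0 < n) :
    phi d r τ ε ≤ phi d r τ (ε / n) := by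
  have hn' : (1 : ℝ) ≤ n := by exact_mod_cast hn
  have : Real.log (ε / n) ≤ Real.log ε :=
    Real.log_le_log (by positivity) (div_le_self hε0.le hn')
  unfold phi
  linarith

lemma exp_neg_phi (hε0 : 0 < ε) :
    Real.exp (-phi d r τ ε / 2) = ε / cellsPerAxis d r τ ^ d := by
  have hκ : 0 < cellsPerAxis d r τ := zero_lt_one.trans_le (one_le_cellsPerAxis d r τ)
  have h : -phi d r τ ε / 2 = Real.log (ε / cellsPerAxis d r τ ^ d) := by
    rw [Real.log_div hε0.ne' (by positivity), Real.log_pow, phi]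
    ring
  rw [h, Real.exp_log (by positivity)]

/-- `φ` is calibrated so that the union bound over the net of `exists_net_card_le` fails with
probability at most `ε`. -/
lemma card_mul_tail_le (hε0 : 0 < ε) (hε1 : ε ≤ 1) {N : ℕ}
    (hN : (N : ℝ) ≤ cellsPerAxis d r τ ^ d ∨ (6 ≤ cellsPerAxis d r τ ∧ 1 ≤ d ∧
      (N : ℝ) ^ 2 ≤ (cellsPerAxis d r τ ^ d) ^ 2 * (9 / 2 * d))) :
    N * (gaussianReal 0 1).real {x | √(phi d r τ ε) < |x|} ≤ ε := by
  have hφ := phi_nonneg (d := d) (r := r) (τ := τ) hε0 hε1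
  have hκ : 0 < cellsPerAxis d r τ := zero_lt_one.trans_le (one_le_cellsPerAxis d r τ)
  have hexp := exp_neg_phi (d := d) (r := r) (τ := τ) hε0
  set κ := cellsPerAxis d r τ with hκdef
  have hκd : 0 < κ ^ d := by positivity
  rcases hN with hN | ⟨h6, hd, hN⟩
  · have htail := gaussianReal_tail_le_exp _ (Real.sqrt_nonneg (phi d r τ ε))
    rw [Real.sq_sqrt hφ, hexp] at htail
    calc _ ≤ κ ^ d * (ε / κ ^ d) := by gcongr
      _ = ε := by field_simp
  · have hd' : (1 : ℝ) ≤ d := by exact_mod_cast hd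
    -- `φ ≥ 2 d log 6 ≥ 3 d`, since `exp (3 / 2) ≤ 6`.
    have hlog : 3 / 2 ≤ Real.log κ := by
      rw [Real.le_log_iff_exp_le hκ]
      refine le_trans ?_ h6
      have h3 : Real.exp (3 / 2) ^ 2 ≤ 6 ^ 2 := by
        rw [← Real.exp_nat_mul]
        have h1 : Real.exp (((2 : ℕ) : ℝ) * (3 / 2)) = Real.exp 1 ^ 3 := by
          rw [← Real.exp_nat_mul]
          norm_num
        rw [h1]
        calc Real.exp 1 ^ 3 ≤ 2.7182818286 ^ 3 := by
              gcongr
              exact Real.exp_one_lt_d9.le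
          _ ≤ 6 ^ 2 := by norm_num
      exact (abs_le_of_sq_le_sq' h3 (by norm_num)).2
    have hφd : 3 * (d : ℝ) ≤ phi d r τ ε := by
      have := Real.log_nonpos hε0.le hε1
      unfold phi
      rw [← hκdef]
      nlinarith
    have hφpos : 0 < phi d r τ ε := by linarith
    have htail := gaussianReal_tail_le_mills _ (Real.sqrt_pos.2 hφpos)
    rw [Real.sq_sqrt hφ, hexp] at htail
    have hmills : N * (√(2 / Real.pi) / √(phi d r τ ε)) ≤ κ ^ d := by
      refine (abs_le_of_sq_le_sq' ?_ hκd.le).2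
      rw [mul_pow, div_pow, Real.sq_sqrt (by positivity), Real.sq_sqrt hφ]
      have hpi := Real.pi_gt_three
      have h1 : 2 / Real.pi / phi d r τ ε ≤ 2 / 3 / (3 * d) := by gcongr
      calc (N : ℝ) ^ 2 * (2 / Real.pi / phi d r τ ε)
          ≤ (κ ^ d) ^ 2 * (9 / 2 * d) * (2 / 3 / (3 * d)) := by gcongr
        _ = (κ ^ d) ^ 2 := by field_simp; norm_num
    calc _ ≤ N * (√(2 / Real.pi) / √(phi d r τ ε) * (ε / κ ^ d)) := by gcongr
      _ = N * (√(2 / Real.pi) / √(phi d r τ ε)) * (ε / κ ^ d) := by ring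
      _ ≤ κ ^ d * (ε / κ ^ d) := by gcongr
      _ = ε := by field_simp

end Phi

section Concentration

variable {d n : ℕ}

/-- The samples of a component and of its measurement noise for which every agent's posterior mean
is within `β` posterior standard deviations of the component on `T`. -/
def concentrationSet (k : Input d → Input d → ℝ) (M : Fin n → ℕ)
    (X : (i : Fin n) → Fin (M i) → Input d) (σo β : ℝ) (T : Finset (Input d)) :
    Set ((Input d → ℝ) × (((i : Fin n) × Fin (M i)) → ℝ)) :=
  {u | ∀ q ∈ T, ∀ i,
    |u.1 q - postMean k (X i) σo (fun a => u.1 (X i a) + u.2 ⟨i, a⟩) q| ≤ β * postStd k (X i) σo q}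

variable {k : Input d → Input d → ℝ} {M : Fin n → ℕ} {X : (i : Fin n) → Fin (M i) → Input d}
  {σo β : ℝ} {T : Finset (Input d)}

lemma measurableSet_concentrationSet : MeasurableSet (concentrationSet k M X σo β T) := by
  have : concentrationSet k M X σo β T = ⋂ q ∈ T, ⋂ i, {u |
      |u.1 q - postMean k (X i) σo (fun a => u.1 (X i a) + u.2 ⟨i, a⟩) q|
        ≤ β * postStd k (X i) σo q} := by
    ext u
    simp [concentrationSet]
  rw [this]
  refine Finset.measurableSet_biInter _ fun q _ => MeasurableSet.iInter fun i => ?_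
  simp only [postMean_eq_sum]
  exact measurableSet_le (by fun_prop) measurable_const

variable {Ω : Type*} {mΩ : MeasurableSpace Ω} {P : Measure Ω}

/-- The union bound over the points of `T` and the agents. -/
lemma IsCenteredGP.one_sub_le_concentrationSet [IsProbabilityMeasure P] {g : Input d → Ω → ℝ}
    (hg : IsCenteredGP k g P) (hgm : ∀ p, Measurable (g p)) (hσo : 0 < σo)
    {z : (i : Fin n) → Fin (M i) → Ω → ℝ} (hzm : ∀ i a, Measurable (z i a))
    (hzlaw : ∀ i a, P.map (z i a) = gaussianReal 0 (Real.toNNReal (σo ^ 2)))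
    (hz : iIndepFun (fun (x : (i : Fin n) × Fin (M i)) => z x.1 x.2) P)
    (hgz : IndepFun (fun ω p => g p ω) (fun ω (x : (i : Fin n) × Fin (M i)) => z x.1 x.2 ω) P) :
    1 - T.card * (n * (gaussianReal 0 1).real {x | β < |x|}) ≤
      P.real {ω | ((fun p => g p ω), fun x : (i : Fin n) × Fin (M i) => z x.1 x.2 ω)
        ∈ concentrationSet k M X σo β T} := by
  let R : Fin n → Input d → Ω → ℝ := fun i q ω =>
    g q ω - postMean k (X i) σo (fun a => g (X i a) ω + z i a ω) q
  have hRm : ∀ i q, Measurable (R i q) := fun i q => by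
    simp only [R, postMean_eq_sum]
    fun_prop
  have hbad : ∀ i q, P.real {ω | β * postStd k (X i) σo q < |R i q ω|}
      ≤ (gaussianReal 0 1).real {x | β < |x|} := fun i q => by
    have hzi : iIndepFun (z i) P := hz.precomp
      (g := fun a : Fin (M i) => (⟨i, a⟩ : (i : Fin n) × Fin (M i))) fun a b hab => by simpa using hab
    have hgzi : IndepFun (fun ω p => g p ω) (fun ω a => z i a ω) P :=
      hgz.comp (φ := id) (ψ := fun (v : ((i : Fin n) × Fin (M i)) → ℝ) a => v ⟨i, a⟩)
        measurable_id (by fun_prop)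
    have hlaw : P.map (R i q) = gaussianReal 0 (postVar k (X i) σo q).toNNReal :=
      hg.map_sub_postMean hσo (hzm i) (hzlaw i) hzi hgzi q
    have hstd : postStd k (X i) σo q = √((postVar k (X i) σo q).toNNReal : ℝ) := by
      rw [postStd, Real.coe_toNNReal']
      rcases le_total 0 (postVar k (X i) σo q) with h | h
      · rw [max_eq_left h]
      · rw [max_eq_right h, Real.sqrt_eq_zero_of_nonpos h, Real.sqrt_zero]
    have hmeas : MeasurableSet {x : ℝ | β * √((postVar k (X i) σo q).toNNReal : ℝ) < |x|} :=
      measurableSet_lt measurable_const measurable_id.abs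
    have := gaussianReal_tail_scale (postVar k (X i) σo q).toNNReal β
    rw [← hlaw, map_measureReal_apply (hRm i q) hmeas, ← hstd] at this
    exact this
  set S := {ω | ((fun p => g p ω), fun x : (i : Fin n) × Fin (M i) => z x.1 x.2 ω)
        ∈ concentrationSet k M X σo β T}
  have hS : MeasurableSet S := by
    have hm : Measurable fun ω =>
        ((fun p => g p ω), fun x : (i : Fin n) × Fin (M i) => z x.1 x.2 ω) := by fun_prop
    exact hm measurableSet_concentrationSet
  have hcompl : Sᶜ ⊆ ⋃ q ∈ T, ⋃ i ∈ (Finset.univ : Finset (Fin n)),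
      {ω | β * postStd k (X i) σo q < |R i q ω|} := by
    intro ω hω
    simp only [S, concentrationSet, Set.mem_compl_iff, Set.mem_ofPred_eq] at hω
    push Not at hω
    obtain ⟨q, hq, i, hi⟩ := hω
    simp only [Set.mem_iUnion]
    exact ⟨q, hq, i, Finset.mem_univ i, hi⟩
  have hle : P.real Sᶜ ≤ T.card * (n * (gaussianReal 0 1).real {x | β < |x|}) := by
    refine (measureReal_mono hcompl (measure_ne_top _ _)).trans ?_
    refine (measureReal_biUnion_finset_le _ _).trans ?_
    rw [← nsmul_eq_mul]
    refine Finset.sum_le_card_nsmul _ _ _ fun q _ => ?_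
    refine (measureReal_biUnion_finset_le _ _).trans ?_
    refine (Finset.sum_le_card_nsmul _ _ _ fun i _ => hbad i q).trans ?_
    simp
  rw [measureReal_compl hS, probReal_univ] at hle
  linarith

end Concentration

/-! ### From the net to the whole set, and aggregation -/

section Deterministic

/-- The passage from a net to a nearby point. The hypothesis on `γ ^ 2 / φ` says that the posterior
variance is large enough to absorb the discretisation error into a second copy of `√φ' * √(V p)`. -/
lemma abs_sub_le_of_net {E : Type*} [PseudoMetricSpace E] {C : Set E} {f μ V : E → ℝ}
    {Lf Lμ Lσ : ℝ≥0} {τ φ φ' : ℝ} (hf : LipschitzOnWith Lf f C) (hμ : LipschitzOnWith Lμ μ C)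
    (hV : LipschitzOnWith Lσ V C) (hφ : 0 < φ) (hφφ' : φ ≤ φ') {p q : E} (hp : p ∈ C) (hq : q ∈ C)
    (hpq : dist p q ≤ τ) (hfμ : |f q - μ q| ≤ √φ' * √(V q))
    (hVp : ((Lf + Lμ) * τ + √(φ * Lσ * τ)) ^ 2 / φ ≤ V p) :
    |f p - μ p| ≤ 2 * √φ' * √(V p) := by
  have hτ : 0 ≤ τ := dist_nonneg.trans hpq
  have h1 : |f p - f q| ≤ Lf * τ := by
    rw [← Real.dist_eq]
    exact (hf.dist_le_mul p hp q hq).trans (by gcongr)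
  have h2 : |μ p - μ q| ≤ Lμ * τ := by
    rw [← Real.dist_eq]
    exact (hμ.dist_le_mul p hp q hq).trans (by gcongr)
  have hVp0 : 0 ≤ V p := le_trans (by positivity) hVp
  have h3 : √(V q) ≤ √(V p) + √(Lσ * τ) := by
    have hVq : V q ≤ V p + Lσ * τ := by
      have h4 := hV.dist_le_mul p hp q hq
      rw [Real.dist_eq] at h4
      have h5 : (Lσ : ℝ) * dist p q ≤ Lσ * τ := by gcongr
      linarith [neg_abs_le (V p - V q)]
    have hLτ : 0 ≤ (Lσ : ℝ) * τ := by positivity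
    refine Real.sqrt_le_iff.2 ⟨by positivity, ?_⟩
    rw [add_sq, Real.sq_sqrt hVp0, Real.sq_sqrt hLτ]
    have : 0 ≤ 2 * √(V p) * √(Lσ * τ) := by positivity
    linarith
  have hs : 0 < √φ := Real.sqrt_pos.2 hφ
  have hss : √φ ≤ √φ' := Real.sqrt_le_sqrt hφφ'
  -- The condition on `V p`, divided by `√φ`.
  have h6 : (Lf + Lμ) * τ / √φ + √(Lσ * τ) ≤ √(V p) := by
    refine Real.le_sqrt_of_sq_le ?_
    refine le_trans (le_of_eq ?_) hVp
    rw [mul_assoc φ, Real.sqrt_mul hφ.le]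
    have : (Lf + Lμ) * τ / √φ + √(Lσ * τ) = ((Lf + Lμ) * τ + √φ * √(Lσ * τ)) / √φ := by
      field_simp
    rw [this, div_pow, Real.sq_sqrt hφ.le]
  have h7 : (Lf + Lμ) * τ ≤ √φ' * ((Lf + Lμ) * τ / √φ) := by
    have h8 : (Lf + Lμ) * τ = √φ * ((Lf + Lμ) * τ / √φ) := by field_simp
    calc _ = √φ * ((Lf + Lμ) * τ / √φ) := h8
      _ ≤ _ := by gcongr
  have h9 : √φ' * ((Lf + Lμ) * τ / √φ + √(Lσ * τ)) ≤ √φ' * √(V p) := by gcongr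
  have h10 : √φ' * √(V q) ≤ √φ' * (√(V p) + √(Lσ * τ)) := by gcongr
  have htri : |f p - μ p| ≤ |f p - f q| + |f q - μ q| + |μ p - μ q| := by
    have := abs_sub_le (f p) (f q) (μ p)
    have := abs_sub_le (f q) (μ q) (μ p)
    rw [abs_sub_comm (μ q)] at this
    linarith
  linarith

variable {d n m : ℕ} {k : Input d → Input d → ℝ} {M : Fin n → ℕ}
  {X : (i : Fin n) → Fin (M i) → Input d} {opt : CoraOption} {N : Finset (Fin n)} {σg : ℝ}

lemma weight_pos (hσg : 0 < σg) {l : Fin n} (hl : l ∈ N) (p : Input d) :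
    0 < weight k M X opt N σg l p := by
  have : adjCheck N l = 1 := if_pos hl
  rw [weight, this]
  positivity

lemma aggWeight_nonneg (hσg : 0 < σg) (l : Fin n) (p : Input d) :
    0 ≤ aggWeight k M X opt N σg l p := by
  unfold aggWeight
  split_ifs with hl
  · exact div_nonneg (weight_pos hσg hl p).le
      (Finset.sum_nonneg fun l' hl' => (weight_pos hσg hl' p).le)
  · exact le_rfl

lemma sum_aggWeight (hσg : 0 < σg) (hN : N.Nonempty) (p : Input d) :
    ∑ l, aggWeight k M X opt N σg l p = 1 := by
  have hpos : 0 < ∑ l ∈ N, weight k M X opt N σg l p :=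
    Finset.sum_pos (fun l hl => weight_pos hσg hl p) hN
  simp only [aggWeight, Finset.sum_ite_mem, Finset.univ_inter]
  rw [← Finset.sum_div, div_self hpos.ne']

/-- A convex combination of the agents' predictions inherits the convex combination of their error
bounds. -/
lemma norm_sub_aggMean_le {σo r τ δ : ℝ} {Y : (l : Fin n) → Fin m → Fin (M l) → ℝ}
    (hσg : 0 < σg) (hN : N.Nonempty) {p : Input d} {y : Fin m → ℝ}
    (h : ∀ l j, |y j - postMean k (X l) σo (Y l j) p|
      ≤ 2 * √(phi d r τ (δ / n)) * postStd k (X l) σo p) :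
    ‖(WithLp.toLp 2 y : EuclideanSpace ℝ (Fin m)) - aggMean k M X σo Y opt N σg p‖
      ≤ etaTilde m k M X σo opt N σg r τ δ p := by
  have hj : ∀ j, |y j - ∑ l, aggWeight k M X opt N σg l p * postMean k (X l) σo (Y l j) p|
      ≤ etaTerm k M X σo opt N σg r τ δ p := fun j => by
    have h1 : y j - ∑ l, aggWeight k M X opt N σg l p * postMean k (X l) σo (Y l j) p
        = ∑ l, aggWeight k M X opt N σg l p * (y j - postMean k (X l) σo (Y l j) p) := by
      simp only [mul_sub, Finset.sum_sub_distrib]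
      rw [← Finset.sum_mul, sum_aggWeight hσg hN, one_mul]
    rw [h1, etaTerm, Finset.mul_sum]
    refine (Finset.abs_sum_le_sum_abs _ _).trans (Finset.sum_le_sum fun l _ => ?_)
    have hw := aggWeight_nonneg (k := k) (M := M) (X := X) (opt := opt) (N := N) hσg l p
    rw [abs_mul, abs_of_nonneg hw]
    calc _ ≤ aggWeight k M X opt N σg l p *
          (2 * √(phi d r τ (δ / n)) * postStd k (X l) σo p) := by
          gcongr
          exact h l j
      _ = _ := by ring
  rw [etaTilde, EuclideanSpace.norm_eq, EuclideanSpace.norm_eq]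
  refine Real.sqrt_le_sqrt (Finset.sum_le_sum fun j _ => ?_)
  refine pow_le_pow_left₀ (norm_nonneg _) ?_ 2
  exact (hj j).trans (le_abs_self _)

end Deterministic

/-! ### The error bound -/

theorem lemma1 {Ωs : Type*} [MeasurableSpace Ωs] (P : Measure Ωs) [IsProbabilityMeasure P]
    {d m n : ℕ}
    -- the kernel
    (k : Input d → Input d → ℝ) (hk_nonneg : ∀ p p', 0 ≤ k p p')
    (hk_lip : ∃ L : ℝ≥0, LipschitzWith L (fun z : Input d × Input d => k z.1 z.2))
    -- the components of the unknown function: independent samples of the Gaussian process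
    (f : Fin m → Input d → Ωs → ℝ) (hf_meas : ∀ j p, Measurable (f j p))
    (hf : ∀ j, IsCenteredGP k (f j) P)
    (hf_indep : iIndepFun (fun j (ω : Ωs) (p : Input d) => f j p ω) P)
    -- the training inputs of the agents and the measurement noise
    (M : Fin n → ℕ) (hM : ∀ i, 0 < M i) (X : (i : Fin n) → Fin (M i) → Input d)
    (σo : ℝ) (hσo : 0 < σo)
    (ζ : (i : Fin n) → Fin m → Fin (M i) → Ωs → ℝ) (hζ_meas : ∀ i j a, Measurable (ζ i j a))
    (hζ : ∀ i j a, P.map (ζ i j a) = gaussianReal 0 (Real.toNNReal (σo ^ 2)))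
    (hζ_indep : iIndepFun
      (fun (x : (i : Fin n) × (Fin m × Fin (M i))) (ω : Ωs) => ζ x.1 x.2.1 x.2.2 ω) P)
    (hfζ_indep : IndepFun (fun (ω : Ωs) (j : Fin m) (p : Input d) => f j p ω)
      (fun (ω : Ωs) (x : (i : Fin n) × (Fin m × Fin (M i))) => ζ x.1 x.2.1 x.2.2 ω) P)
    -- the compact set and the parameters
    (K : Set (Input d)) (hK : IsCompact K) (τ δ : ℝ) (hτ : 0 < τ) (hδ0 : 0 < δ) (hδ1 : δ < 1) :
    ∃ S : Set Ωs, MeasurableSet S ∧ (1 - δ) ^ m ≤ P.real S ∧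
      ∀ ω ∈ S, ∀ Y : (i : Fin n) → Fin m → Fin (M i) → ℝ,
        -- the training targets
        (∀ i j a, Y i j a = f j (X i a) ω + ζ i j a ω) →
        -- Lipschitz constants of the unknown function, the posterior means and variances
        ∀ (Lf : ℝ≥0) (Lμ : Fin n → Fin m → ℝ≥0) (Lσ : Fin n → ℝ≥0),
        (∀ j, LipschitzOnWith Lf (fun p => f j p ω) (convexHull ℝ K)) →
        (∀ i j, LipschitzOnWith (Lμ i j) (postMean k (X i) σo (Y i j)) (convexHull ℝ K)) →
        (∀ i, LipschitzOnWith (Lσ i) (postVar k (X i) σo) (convexHull ℝ K)) →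
        -- the condition on `τ` and `δ`
        (∀ i j, ∀ p ∈ K,
          gammaTerm d (Metric.diam K) τ δ Lf (Lμ i j) (Lσ i) ^ 2 / phi d (Metric.diam K) τ δ
            ≤ postVar k (X i) σo p) →
        -- both variants of Cora-GP, with arbitrary nonempty neighbour sets
        ∀ (opt : CoraOption) (σg : Fin n → ℝ) (N : Fin n → Finset (Fin n)),
        (∀ i, 0 < σg i) → (∀ i, (N i).Nonempty) →
        ∀ i, ∀ p ∈ K,
          ‖(WithLp.toLp 2 fun j => f j p ω : EuclideanSpace ℝ (Fin m)) -
              aggMean k M X σo Y opt (N i) (σg i) p‖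
            ≤ etaTilde m k M X σo opt (N i) (σg i) (Metric.diam K) τ δ p := by
  obtain ⟨T, hTsub, hTnet, hTcard⟩ := exists_net_card_le K hK hτ
  set β := √(phi d (Metric.diam K) τ (δ / n)) with hβ
  let Z : Fin m → Ωs → ((i : Fin n) × Fin (M i)) → ℝ := fun j ω x => ζ x.1 j x.2 ω
  let W : (j : Fin m) → Ωs → (Input d → ℝ) × (((i : Fin n) × Fin (M i)) → ℝ) :=
    fun j ω => (fun p => f j p ω, Z j ω)
  have hFm : ∀ j, Measurable fun ω p => f j p ω := fun j => by fun_prop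
  have hZm : ∀ j, Measurable (Z j) := fun j => by fun_prop
  -- Regroup the noise by output components.
  have hζ' : iIndepFun (fun (x : (_ : Fin m) × ((i : Fin n) × Fin (M i))) (ω : Ωs) =>
      ζ x.2.1 x.1 x.2.2 ω) P :=
    hζ_indep.precomp (g := fun x : (_ : Fin m) × ((i : Fin n) × Fin (M i)) =>
      (⟨x.2.1, x.1, x.2.2⟩ : (i : Fin n) × (Fin m × Fin (M i)))) <| by
        rintro ⟨j, i, a⟩ ⟨j', i', a'⟩ h
        simp only [Sigma.mk.injEq] at h
        obtain ⟨rfl, h⟩ := h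
        simp_all
  have hZ : iIndepFun Z P :=
    iIndepFun_curry (X := fun j (x : (i : Fin n) × Fin (M i)) ω => ζ x.1 j x.2 ω)
      (fun j x => hζ_meas x.1 j x.2) hζ'
  have hFZ : IndepFun (fun ω j p => f j p ω) (fun ω j => Z j ω) P :=
    hfζ_indep.comp (φ := id) (ψ := fun (v : ((i : Fin n) × (Fin m × Fin (M i))) → ℝ) (j : Fin m)
      (x : (i : Fin n) × Fin (M i)) => v ⟨x.1, j, x.2⟩) measurable_id (by fun_prop)
  have hW : iIndepFun W P := iIndepFun_prodMk hFm hZm hf_indep hZ hFZ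
  have hWm : ∀ j, Measurable (W j) := fun j => (hFm j).prodMk (hZm j)
  let G := concentrationSet k M X σo β T
  have hGm : MeasurableSet G := measurableSet_concentrationSet
  have hfail : T.card * (n * (gaussianReal 0 1).real {x | β < |x|}) ≤ δ := by
    -- Without agents `δ / n` is the junk value `0`, but then no event can fail.
    rcases Nat.eq_zero_or_pos n with hn | hn
    · subst hn
      simp [hδ0.le]
    · have hn' : (1 : ℝ) ≤ n := by exact_mod_cast hn
      have := card_mul_tail_le (ε := δ / n) (by positivity)
        ((div_le_self hδ0.le hn').trans hδ1.le) hTcard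
      rw [le_div_iff₀ (by positivity)] at this
      linarith
  have hcomp : ∀ j, 1 - δ ≤ P.real (W j ⁻¹' G) := fun j => by
    have hζj : iIndepFun (fun x : (i : Fin n) × Fin (M i) => ζ x.1 j x.2) P :=
      hζ'.precomp (g := fun x : (i : Fin n) × Fin (M i) =>
        (⟨j, x⟩ : (_ : Fin m) × ((i : Fin n) × Fin (M i)))) fun x y hxy => by simpa using hxy
    have hfζj : IndepFun (fun ω p => f j p ω)
        (fun ω (x : (i : Fin n) × Fin (M i)) => ζ x.1 j x.2 ω) P :=
      hFZ.comp (φ := fun u : Fin m → Input d → ℝ => u j)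
        (ψ := fun v : Fin m → ((i : Fin n) × Fin (M i)) → ℝ => v j) (by fun_prop) (by fun_prop)
    have := (hf j).one_sub_le_concentrationSet (T := T) (β := β) (X := X)
      (z := fun i a => ζ i j a) (hf_meas j) hσo
      (fun i a => hζ_meas i j a) (fun i a => hζ i j a) hζj hfζj
    exact le_trans (by linarith) this
  refine ⟨⋂ j, W j ⁻¹' G, MeasurableSet.iInter fun j => hWm j hGm, ?_, ?_⟩
  · have hprod : P.real (⋂ j, W j ⁻¹' G) = ∏ j, P.real (W j ⁻¹' G) := by
      have := hW.measure_inter_preimage_eq_mul Finset.univ (sets := fun _ => G) fun _ _ => hGm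
      simp only [Finset.mem_univ, Set.iInter_true] at this
      simp only [measureReal_def, this, ENNReal.toReal_prod]
    rw [hprod]
    calc (1 - δ) ^ m = ∏ _j : Fin m, (1 - δ) := by simp
      _ ≤ _ := Finset.prod_le_prod (fun _ _ => by linarith) fun j _ => hcomp j
  · intro ω hω Y hY Lf Lμ Lσ hLf hLμ hLσ hcond opt σg N hσg hN i p hp
    refine norm_sub_aggMean_le (hσg i) (hN i) fun l j => ?_
    obtain ⟨q, hqT, hpq⟩ := hTnet p hp
    have hgood := Set.mem_iInter.1 hω j q hqT l
    have hYj : Y l j = fun a => f j (X l a) ω + ζ l j a ω := funext fun a => hY l j a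
    refine abs_sub_le_of_net (hLf j) (hLμ l j) (hLσ l) (phi_pos hδ0 hδ1)
      (phi_le_phi_div hδ0 i.pos) (subset_convexHull ℝ K hp) (hTsub hqT) hpq ?_ (hcond l j p hp)
    rw [hYj]
    exact hgood
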